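/- Let $X$ be a topological space with lattice $\mathcal O(X)$ of open sets. A subset of $X$ is saturated if it is the intersection of all open sets containing it. Let $\mathsf K(X)$ be the set of all nonempty compact saturated subsets of $X$, ordered by the Smyth order: $K_1\sqsubseteq K_2$ iff $K_2\subseteq K_1$. The upper Vietoris topology on $\mathsf K(X)$ is the topology with base $\{\Box U : U\in\mathcal O(X)\}$, where $\Box U=\{K\in\mathsf K(X) : K\subseteq U\}$. Directed sets are understood to be nonempty. The Scott topology of a poset $P$ consists of the upper sets $\mathcal U\subseteq P$ that meet every directed subset $D\subseteq P$ whose supremum exists in $P$ and belongs to $\mathcal U$. The space $X$ is core compact if $(\mathcal O(X),\subseteq)$ is a continuous lattice, that is, every $U\in\mathcal O(X)$ is the union of all $V\in\mathcal O(X)$ with $V\ll U$; here $V\ll U$ means that every directed family of open sets whose union contains $U$ has a member that contains $V$. The space $X$ is well-filtered if it is $T_0$ and, for every open set $U$ and every family $\mathcal K\subseteq\mathsf K(X)$ that is directed in the Smyth order, $\bigcap\mathcal K\subseteq U$ implies $K\subseteq U$ for some $K\in\mathcal K$. Theorem. If $X$ is a core compact well-filtered space, then the upper Vietoris topology and the Scott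 topology of the Smyth order coincide on $\mathsf K(X)$. -/

import Mathlib

open Set TopologicalSpace

/-- The way-below relation `x ≪ y` of a poset: every (nonempty) directed set `D` that has a
supremum above `y` contains an element above `x`. -/
def WayBelow {L : Type*} [PartialOrder L] (x y : L) : Prop :=
  ∀ (D : Set L) (s : L), D.Nonempty → DirectedOn (· ≤ ·) D → IsLUB D s → y ≤ s → ∃ d ∈ D, x ≤ d

/-- A complete lattice is a continuous lattice if every element is the supremum of the elements
way below it. -/
def IsContinuousLattice (L : Type*) [CompleteLattice L] : Prop :=
  ∀ x : L, IsLUB {y : L | WayBelow y x} x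

/-- A space is core compact if its lattice of open sets is a continuous lattice. -/
def CoreCompact (X : Type*) [TopologicalSpace X] : Prop :=
  IsContinuousLattice (Opens X)

/-- A set is saturated if it is the intersection of all the open sets containing it. -/
def SaturatedSet {X : Type*} [TopologicalSpace X] (A : Set X) : Prop :=
  A = ⋂₀ {U : Set X | IsOpen U ∧ A ⊆ U}

/-- `KSat X` is the set of all nonempty compact saturated subsets of `X`. -/
@[ext]
structure KSat (X : Type*) [TopologicalSpace X] where
  /-- the underlying set of points -/
  carrier : Set X
  nonempty : carrier.Nonempty
  isCompact : IsCompact carrier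
  saturated : SaturatedSet carrier

/-- The Smyth order on `KSat X`, which is reverse inclusion: `K₁ ≤ K₂` means `K₂ ⊆ K₁`. -/
instance KSat.instPartialOrder (X : Type*) [TopologicalSpace X] : PartialOrder (KSat X) where
  le K₁ K₂ := K₂.carrier ⊆ K₁.carrier
  le_refl _ := Subset.rfl
  le_trans _ _ _ h₁ h₂ := h₂.trans h₁
  le_antisymm _ _ h₁ h₂ := KSat.ext (h₂.antisymm h₁)

/-- `boxSet U` is the set of all nonempty compact saturated sets contained in `U`. -/
def boxSet {X : Type*} [TopologicalSpace X] (U : Set X) : Set (KSat X) :=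
  {K : KSat X | K.carrier ⊆ U}

/-- The upper Vietoris topology on `KSat X`, generated by the sets `boxSet U` with `U` open. -/
@[reducible]
def upperVietoris (X : Type*) [TopologicalSpace X] : TopologicalSpace (KSat X) :=
  generateFrom {B : Set (KSat X) | ∃ U : Set X, IsOpen U ∧ B = boxSet U}

/-- The generating sets of the upper Vietoris topology form a base of it. -/
theorem isTopologicalBasis_upperVietoris (X : Type*) [TopologicalSpace X] :
    @IsTopologicalBasis (KSat X) (upperVietoris X)
      {B : Set (KSat X) | ∃ U : Set X, IsOpen U ∧ B = boxSet U} := by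
  let _ := upperVietoris X
  refine ⟨?_, ?_, rfl⟩
  · rintro _ ⟨U, hU, rfl⟩ _ ⟨V, hV, rfl⟩ K ⟨hKU, hKV⟩
    exact ⟨boxSet (U ∩ V), ⟨U ∩ V, hU.inter hV, rfl⟩, subset_inter hKU hKV,
      fun K' h => ⟨h.trans inter_subset_left, h.trans inter_subset_right⟩⟩
  · exact sUnion_eq_univ_iff.2 fun K => ⟨boxSet univ, ⟨univ, isOpen_univ, rfl⟩, subset_univ _⟩

/-- The Scott topology of a poset: the open sets are the upper sets `U` such that every (nonempty)
directed set whose supremum exists and lies in `U` meets `U`. -/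
@[reducible]
def scottTopology (P : Type*) [PartialOrder P] : TopologicalSpace P :=
  Topology.scott P univ

theorem isOpen_scottTopology_iff {P : Type*} [PartialOrder P] {U : Set P} :
    @IsOpen P (scottTopology P) U ↔ IsUpperSet U ∧
      ∀ (D : Set P) (s : P), D.Nonempty → DirectedOn (· ≤ ·) D → IsLUB D s → s ∈ U →
        (D ∩ U).Nonempty := by
  let _ := scottTopology P
  have : Topology.IsScott P univ := ⟨rfl⟩
  rw [Topology.IsScott.isOpen_iff_isUpperSet_and_dirSupInaccOn (D := univ)]
  refine and_congr_right fun _ => ⟨fun h D s h₁ h₂ h₃ h₄ => h (mem_univ D) h₁ h₂ h₃ h₄,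
    fun h D _ h₁ h₂ s h₃ h₄ => h D s h₁ h₂ h₃ h₄⟩

/-- A space is well-filtered if it is `T₀` and, for every open `U`, every family of nonempty compact
saturated sets that is directed in the Smyth order and has its intersection contained in `U` has a
member contained in `U`. -/
structure WellFiltered (X : Type*) [TopologicalSpace X] : Prop where
  t0 : T0Space X
  exists_subset : ∀ (U : Set X) (F : Set (KSat X)), IsOpen U → F.Nonempty →
    DirectedOn (· ≤ ·) F → (⋂ K ∈ F, K.carrier) ⊆ U → ∃ K ∈ F, K.carrier ⊆ U

/-!
Well-filteredness turns suprema of directed sets in the Smyth order into intersections, so each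
`boxSet U` is Scott open. Conversely, if `X` is locally compact, then a compact saturated set `K` is
the directed supremum of its compact saturated neighbourhoods `Q`, so a Scott open set containing
`K` contains some `Q`, and with it the neighbourhood `boxSet (interior Q)` of `K`.

That a core compact well-filtered space is locally compact is seen as follows. Interpolation gives,
between open sets `U ≪ W`, a sequence of open sets `V n` with `V (n + 1) ≪ V n`, and it suffices
that `⋂ n, V n` is compact. For this one shows that an open set `U` containing `⋂ n, V n` contains
some `V n`. Otherwise, by Zorn's lemma, `U` lies in an open set `M` maximal among those containing
no `V n`. Choose `x n ∈ V n \ M`. If an open set `W` is not contained in `M`, then by maximality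
`M ∪ W` contains some `V k`, so `W` contains `x m` for all `m ≥ k`. Hence the sequence `x` converges
to each of its terms, its tails are compact, and well-filteredness applied to their saturations
puts some tail inside `U ⊆ M`, which is absurd.
-/

open Filter Topology

section WayBelow

variable {L : Type*}

section PartialOrder

variable [PartialOrder L] {w x y z : L}

theorem WayBelow.le (h : WayBelow x y) : x ≤ y := by
  obtain ⟨_, rfl, hxy⟩ :=
    h {y} y (singleton_nonempty y) (directedOn_singleton y) isLUB_singleton le_rfl
  exact hxy

theorem WayBelow.trans_le (hxy : WayBelow x y) (hyz : y ≤ z) : WayBelow x z :=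
  fun D s hne hdir hs hzs => hxy D s hne hdir hs (hyz.trans hzs)

theorem WayBelow.of_le_left (hwx : w ≤ x) (hxy : WayBelow x y) : WayBelow w y :=
  fun D s hne hdir hs hys => (hxy D s hne hdir hs hys).imp fun _ hd => ⟨hd.1, hwx.trans hd.2⟩

theorem wayBelow_bot [OrderBot L] : WayBelow ⊥ x :=
  fun _ _ hne _ _ _ => hne.imp fun _ hd => ⟨hd, bot_le⟩

end PartialOrder

theorem WayBelow.sup [SemilatticeSup L] {x y z : L} (hx : WayBelow x z) (hy : WayBelow y z) :
    WayBelow (x ⊔ y) z := by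
  intro D s hne hdir hs hzs
  obtain ⟨d, hd, hxd⟩ := hx D s hne hdir hs hzs
  obtain ⟨e, he, hye⟩ := hy D s hne hdir hs hzs
  obtain ⟨f, hf, hdf, hef⟩ := hdir d hd e he
  exact ⟨f, hf, sup_le (hxd.trans hdf) (hye.trans hef)⟩

variable [CompleteLattice L] {x y : L}

theorem WayBelow.exists_mem_le_of_le_sSup (h : WayBelow x y) {D : Set L} (hne : D.Nonempty)
    (hdir : DirectedOn (· ≤ ·) D) (hy : y ≤ sSup D) : ∃ d ∈ D, x ≤ d :=
  h D (sSup D) hne hdir (isLUB_sSup D) hy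

theorem WayBelow.exists_finset_le_of_le_iSup {ι : Type*} (h : WayBelow x y) {f : ι → L}
    (hy : y ≤ ⨆ i, f i) : ∃ t : Finset ι, x ≤ ⨆ i ∈ t, f i := by
  have hmono : Monotone fun t : Finset ι => ⨆ i ∈ t, f i := fun _ _ hst => biSup_mono hst
  rw [iSup_eq_iSup_finset] at hy
  obtain ⟨_, ⟨t, rfl⟩, ht⟩ := h.exists_mem_le_of_le_sSup (range_nonempty _)
    (directedOn_range.2 hmono.directed_le) hy
  exact ⟨t, ht⟩

theorem IsContinuousLattice.exists_wayBelow_wayBelow (hL : IsContinuousLattice L)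
    (h : WayBelow x y) : ∃ z, WayBelow x z ∧ WayBelow z y := by
  let D : Set L := {a | ∃ b, WayBelow a b ∧ WayBelow b y}
  have hne : D.Nonempty := ⟨⊥, ⊥, wayBelow_bot, wayBelow_bot⟩
  have hdir : DirectedOn (· ≤ ·) D := by
    rintro a ⟨b, hab, hby⟩ a' ⟨b', hab', hby'⟩
    exact ⟨a ⊔ a', ⟨b ⊔ b', (hab.trans_le le_sup_left).sup (hab'.trans_le le_sup_right),
      hby.sup hby'⟩, le_sup_left, le_sup_right⟩
  have hlub : y ≤ sSup D :=
    (hL y).2 fun b hby => (hL b).2 fun a hab => le_sSup ⟨b, hab, hby⟩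
  obtain ⟨d, ⟨z, hdz, hzy⟩, hxd⟩ := h.exists_mem_le_of_le_sSup hne hdir hlub
  exact ⟨z, hdz.of_le_left hxd, hzy⟩

theorem IsContinuousLattice.exists_seq_wayBelow (hL : IsContinuousLattice L) (h : WayBelow x y) :
    ∃ v : ℕ → L, (∀ n, WayBelow (v (n + 1)) (v n)) ∧ ∀ n, v n ∈ Icc x y := by
  choose! g hxg hg using fun z (hz : WayBelow x z) => hL.exists_wayBelow_wayBelow hz
  have hxv (n : ℕ) : WayBelow x (g^[n] y) := by
    induction n with
    | zero => exact h
    | succ n ih => exact Function.iterate_succ_apply' g n y ▸ hxg _ ih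
  have hv (n : ℕ) : WayBelow (g^[n + 1] y) (g^[n] y) :=
    Function.iterate_succ_apply' g n y ▸ hg _ (hxv n)
  have hanti : Antitone fun n => g^[n] y := antitone_nat_of_succ_le fun n => (hv n).le
  exact ⟨fun n => g^[n] y, hv, fun n => ⟨(hxv n).le, hanti n.zero_le⟩⟩

theorem exists_le_maximal_forall_not_le {ι : Sort*} {v : ι → L}
    (hv : ∀ i, ∃ j, WayBelow (v j) (v i)) {u : L} (hu : ∀ i, ¬ v i ≤ u) :
    ∃ m, u ≤ m ∧ Maximal (fun w => ∀ i, ¬ v i ≤ w) m := by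
  refine zorn_le_nonempty₀ {w | ∀ i, ¬ v i ≤ w} (fun c hc hchain w hw => ?_) u hu
  refine ⟨sSup c, fun i hi => ?_, fun _ => le_sSup⟩
  obtain ⟨j, hj⟩ := hv i
  obtain ⟨d, hd, hjd⟩ := hj.exists_mem_le_of_le_sSup ⟨w, hw⟩ hchain.directedOn hi
  exact hc hd j hjd

end WayBelow

section Saturated

variable {X : Type*} [TopologicalSpace X]

theorem saturatedSet_iff_nhdsKer_eq {A : Set X} : SaturatedSet A ↔ nhdsKer A = A := by
  rw [SaturatedSet, ← nhdsKer_def, eq_comm]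

theorem SaturatedSet.iInter {ι : Sort*} {A : ι → Set X} (h : ∀ i, SaturatedSet (A i)) :
    SaturatedSet (⋂ i, A i) := by
  refine saturatedSet_iff_nhdsKer_eq.2 (nhdsKer_iInter_subset.trans ?_ |>.antisymm subset_nhdsKer)
  exact iInter_mono fun i => (saturatedSet_iff_nhdsKer_eq.1 (h i)).subset

/-- The saturation of a nonempty compact set, that is, the least element of `KSat X` under inclusion
that contains it. -/
def KSat.saturation (B : Set X) (hB : IsCompact B) (hne : B.Nonempty) : KSat X where
  carrier := nhdsKer B
  nonempty := hne.mono subset_nhdsKer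
  isCompact := IsCompact.nhdsKer_iff.2 hB
  saturated := saturatedSet_iff_nhdsKer_eq.2 (nhdsKer_nhdsKer B)

end Saturated

section WellFiltered

variable {X : Type*} [TopologicalSpace X]

theorem WellFiltered.exists_subset_of_directed (hwf : WellFiltered X) {ι : Type*} [Nonempty ι]
    {B : ι → Set X} (hdir : Directed (· ⊇ ·) B) (hB : ∀ i, IsCompact (B i))
    (hne : ∀ i, (B i).Nonempty) {U : Set X} (hU : IsOpen U) (hBU : ⋂ i, nhdsKer (B i) ⊆ U) :
    ∃ i, B i ⊆ U := by
  let K (i : ι) : KSat X := .saturation (B i) (hB i) (hne i)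
  have hK : Directed (· ≤ ·) K := fun i j =>
    (hdir i j).imp fun _ h => ⟨nhdsKer_subset_nhdsKer h.1, nhdsKer_subset_nhdsKer h.2⟩
  obtain ⟨_, ⟨i, rfl⟩, hi⟩ := hwf.exists_subset U (range K) hU (range_nonempty K)
    (directedOn_range.2 hK) (by rwa [biInter_range])
  exact ⟨i, subset_nhdsKer.trans hi⟩

theorem tendsto_nhds_of_maximal_forall_not_le {ι : Type*} [Preorder ι] {V : ι → Opens X}
    (hV : Antitone V) {M : Opens X} (hM : Maximal (fun W => ∀ i, ¬ V i ≤ W) M) {x : ι → X}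
    (hxV : ∀ i, x i ∈ V i) (hxM : ∀ i, x i ∉ M) {y : X} (hy : y ∉ M) :
    Tendsto x atTop (𝓝 y) := by
  refine tendsto_nhds.2 fun W hW hyW => ?_
  obtain ⟨k, hk⟩ : ∃ k, V k ≤ M ⊔ ⟨W, hW⟩ := by
    by_contra! h
    exact hy (hM.le_of_ge h le_sup_left (Or.inr hyW))
  filter_upwards [eventually_ge_atTop k] with i hki
  exact (hk (hV hki (hxV i))).resolve_left (hxM i)

theorem WellFiltered.exists_le_of_iInter_subset (hwf : WellFiltered X) {V : ℕ → Opens X}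
    (hV : ∀ n, WayBelow (V (n + 1)) (V n)) {U : Opens X} (hU : ⋂ n, (V n : Set X) ⊆ U) :
    ∃ n, V n ≤ U := by
  by_contra! hVU
  have hanti : Antitone V := antitone_nat_of_succ_le fun n => (hV n).le
  obtain ⟨M, hUM, hM⟩ := exists_le_maximal_forall_not_le (fun n => ⟨n + 1, hV n⟩) hVU
  choose x hxV hxM using fun n => SetLike.not_le_iff_exists.1 (hM.prop n)
  let tail (n : ℕ) : Set X := range fun m => x (m + n)
  have tail_anti : Antitone tail := by
    rintro k n hkn _ ⟨m, rfl⟩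
    exact ⟨m + (n - k), congrArg x (by lia)⟩
  have tail_compact (n : ℕ) : IsCompact (tail n) := by
    have hx : Tendsto (fun m => x (m + n)) atTop (𝓝 (x n)) := (tendsto_add_atTop_iff_nat n).2
      (tendsto_nhds_of_maximal_forall_not_le hanti hM hxV hxM (hxM n))
    have hmem : x n ∈ tail n := ⟨0, congrArg x n.zero_add⟩
    exact insert_eq_of_mem hmem ▸ hx.isCompact_insert_range
  have tail_subset (n : ℕ) : tail n ⊆ V n :=
    range_subset_iff.2 fun m => hanti (n.le_add_left m) (hxV (m + n))
  obtain ⟨n, hn⟩ := hwf.exists_subset_of_directed tail_anti.directed_ge tail_compact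
    (fun _ => range_nonempty _) U.isOpen
    ((iInter_mono fun n => nhdsKer_minimal (tail_subset n) (V n).isOpen).trans hU)
  exact hxM (0 + n) (hUM (hn ⟨0, rfl⟩))

theorem WellFiltered.isCompact_iInter_of_wayBelow (hwf : WellFiltered X) {V : ℕ → Opens X}
    (hV : ∀ n, WayBelow (V (n + 1)) (V n)) : IsCompact (⋂ n, (V n : Set X)) := by
  refine isCompact_of_finite_subcover fun {ι} W hW hVW => ?_
  lift W to ι → Opens X using hW
  rw [← Opens.coe_iSup] at hVW
  obtain ⟨n, hn⟩ := hwf.exists_le_of_iInter_subset hV hVW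
  obtain ⟨t, ht⟩ := (hV n).exists_finset_le_of_le_iSup hn
  refine ⟨t, (iInter_subset _ (n + 1)).trans ?_⟩
  simpa only [← SetLike.coe_subset_coe, Opens.coe_iSup] using ht

theorem CoreCompact.exists_wayBelow_mem (hcc : CoreCompact X) {W : Opens X} {x : X} (hx : x ∈ W) :
    ∃ U : Opens X, WayBelow U W ∧ x ∈ U := by
  rw [← (hcc W).sSup_eq] at hx
  exact Opens.mem_sSup.1 hx

theorem CoreCompact.locallyCompactSpace (hcc : CoreCompact X) (hwf : WellFiltered X) :
    LocallyCompactSpace X := by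
  refine ⟨fun x N hN => ?_⟩
  obtain ⟨W, hWN, hW, hxW⟩ := mem_nhds_iff.1 hN
  obtain ⟨U, hUW, hxU⟩ := hcc.exists_wayBelow_mem (W := ⟨W, hW⟩) hxW
  obtain ⟨V, hV, hUVW⟩ := IsContinuousLattice.exists_seq_wayBelow hcc hUW
  have hUV : (U : Set X) ⊆ ⋂ n, (V n : Set X) := subset_iInter fun n => (hUVW n).1
  exact ⟨⋂ n, (V n : Set X), mem_of_superset (U.isOpen.mem_nhds hxU) hUV,
    ((iInter_subset _ 0).trans (hUVW 0).2).trans hWN, hwf.isCompact_iInter_of_wayBelow hV⟩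

section DirectedInter

variable {D : Set (KSat X)}

theorem WellFiltered.nonempty_biInter (hwf : WellFiltered X) (hne : D.Nonempty)
    (hdir : DirectedOn (· ≤ ·) D) : (⋂ K ∈ D, K.carrier).Nonempty := by
  by_contra! hempty
  obtain ⟨K, -, hK⟩ := hwf.exists_subset ∅ D isOpen_empty hne hdir hempty.subset
  exact not_nonempty_empty (K.nonempty.mono hK)

theorem WellFiltered.isCompact_biInter (hwf : WellFiltered X) (hne : D.Nonempty)
    (hdir : DirectedOn (· ≤ ·) D) : IsCompact (⋂ K ∈ D, K.carrier) := by
  refine isCompact_of_finite_subcover fun W hW hDW => ?_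
  obtain ⟨K, hK, hKW⟩ := hwf.exists_subset _ D (isOpen_iUnion hW) hne hdir hDW
  obtain ⟨t, ht⟩ := K.isCompact.elim_finite_subcover W hW hKW
  exact ⟨t, (biInter_subset_of_mem hK).trans ht⟩

theorem WellFiltered.carrier_eq_biInter_of_isLUB (hwf : WellFiltered X) {K : KSat X}
    (hne : D.Nonempty) (hdir : DirectedOn (· ≤ ·) D) (hK : IsLUB D K) :
    K.carrier = ⋂ Q ∈ D, Q.carrier := by
  let I : KSat X := ⟨⋂ Q ∈ D, Q.carrier, hwf.nonempty_biInter hne hdir,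
    hwf.isCompact_biInter hne hdir, .iInter fun Q => .iInter fun _ => Q.saturated⟩
  have hI : I ∈ upperBounds D := fun _ hQ => biInter_subset_of_mem hQ
  exact Subset.antisymm (subset_iInter₂ fun _ hQ => hK.1 hQ) (hK.2 hI)

end DirectedInter

theorem WellFiltered.scottTopology_le_upperVietoris (hwf : WellFiltered X) :
    scottTopology (KSat X) ≤ upperVietoris X := by
  refine le_generateFrom ?_
  rintro _ ⟨U, hU, rfl⟩
  refine isOpen_scottTopology_iff.2 ⟨fun _ _ hKQ hK => Subset.trans hKQ hK, ?_⟩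
  intro D K hne hdir hlub (hKU : K.carrier ⊆ U)
  rw [hwf.carrier_eq_biInter_of_isLUB hne hdir hlub] at hKU
  exact hwf.exists_subset U D hU hne hdir hKU

end WellFiltered

section LocallyCompact

variable {X : Type*} [TopologicalSpace X]

/-- The compact saturated neighbourhoods of a compact saturated set `K`, a directed set in the Smyth
order that approximates `K` if the space is locally compact. -/
def KSat.neighborhoods (K : KSat X) : Set (KSat X) :=
  {Q | K.carrier ⊆ interior Q.carrier}

variable [LocallyCompactSpace X]

theorem KSat.exists_mem_neighborhoods_subset {K : KSat X} {U : Set X} (hU : IsOpen U)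
    (hKU : K.carrier ⊆ U) : ∃ Q ∈ K.neighborhoods, Q.carrier ⊆ U := by
  obtain ⟨B, hB, hKB, hBU⟩ := exists_compact_between K.isCompact hU hKU
  exact ⟨.saturation B hB (K.nonempty.mono (hKB.trans interior_subset)),
    hKB.trans (interior_mono subset_nhdsKer), nhdsKer_minimal hBU hU⟩

theorem KSat.nonempty_neighborhoods (K : KSat X) : K.neighborhoods.Nonempty :=
  let ⟨Q, hQ, _⟩ := exists_mem_neighborhoods_subset isOpen_univ (subset_univ K.carrier)
  ⟨Q, hQ⟩

theorem KSat.directedOn_neighborhoods (K : KSat X) : DirectedOn (· ≤ ·) K.neighborhoods := by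
  intro Q₁ h₁ Q₂ h₂
  obtain ⟨Q, hQ, hQQ⟩ := exists_mem_neighborhoods_subset
    (isOpen_interior.inter isOpen_interior) (subset_inter h₁ h₂)
  obtain ⟨hQ₁, hQ₂⟩ := subset_inter_iff.1 hQQ
  exact ⟨Q, hQ, hQ₁.trans interior_subset, hQ₂.trans interior_subset⟩

theorem KSat.isLUB_neighborhoods (K : KSat X) : IsLUB K.neighborhoods K := by
  refine ⟨fun Q hQ => Subset.trans hQ interior_subset, fun Q hQ => ?_⟩
  have hQK : Q.carrier ⊆ nhdsKer K.carrier := subset_nhdsKer_iff.2 fun U hU hKU =>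
    let ⟨_, hP, hPU⟩ := exists_mem_neighborhoods_subset hU hKU
    Subset.trans (hQ hP) hPU
  exact hQK.trans (saturatedSet_iff_nhdsKer_eq.1 K.saturated).subset

theorem upperVietoris_le_scottTopology : upperVietoris X ≤ scottTopology (KSat X) := by
  let _ := upperVietoris X
  intro 𝒰 h𝒰
  obtain ⟨hupper, hinacc⟩ := isOpen_scottTopology_iff.1 h𝒰
  refine (isTopologicalBasis_upperVietoris X).isOpen_iff.2 fun K hK => ?_
  obtain ⟨Q, hKQ, hQ⟩ := hinacc _ K K.nonempty_neighborhoods K.directedOn_neighborhoods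
    K.isLUB_neighborhoods hK
  have hbox : boxSet (interior Q.carrier) ⊆ 𝒰 :=
    fun _ hP => hupper (Subset.trans hP interior_subset) hQ
  exact ⟨boxSet (interior Q.carrier), ⟨_, isOpen_interior, rfl⟩, hKQ, hbox⟩

end LocallyCompact

theorem mainTheorem1 (X : Type*) [TopologicalSpace X] (hcc : CoreCompact X)
    (hwf : WellFiltered X) : upperVietoris X = scottTopology (KSat X) := by
  have := hcc.locallyCompactSpace hwf
  exact le_antisymm upperVietoris_le_scottTopology hwf.scottTopology_le_upperVietoris
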